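/- For $n\ge 0$ let $\mathrm{LC}_g(\mathbb{R}^n)$ be the class of geometric log-concave functions with finite positive integral: upper semi-continuous functions $f:\mathbb{R}^n\to[0,1]$ such that $\log f$ is concave (as a function with values in $[-\infty,0]$), $\max f=f(0)=1$ and $0<\int_{\mathbb{R}^n} f(x)\,dx<\infty$. For measurable $f,g:\mathbb{R}^n\to[0,\infty)$ let $$N(f,g)=\inf\Big\{\mu(\mathbb{R}^n)\;:\;\int_{\mathbb{R}^n} g(x-t)\,d\mu(t)\ge f(x)\ \text{ for all } x\in\mathbb{R}^n\Big\}\in[0,\infty],$$ where the infimum is over all non-negative Borel measures $\mu$ on $\mathbb{R}^n$. For $0<\lambda<1$ put $f_\lambda(x)=f(x/\lambda)^\lambda$. **Theorem.** Let $f\in \mathrm{LC}_g(\mathbb{R}^n)$. Then the limit $\lim_{\lambda\to1^-}N(f,f_\lambda)$ exists. If $f$ is even, then $$\lim_{\lambda\to1^-}N(f,f_\lambda)\le 2^n .$$ In general (for $f$ not necessarily even), $$\lim_{\lambda\to1^-}N(f,f_\lambda)\le 4^n .$$ -/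

import Mathlib

open MeasureTheory Filter Topology
open scoped ENNReal

/-- A non-negative Borel measure `μ` on `ℝⁿ` is a covering measure of `f` by `g` if `μ * g ≥ f`
everywhere, i.e. `∫ g (x - t) dμ(t) ≥ f x` for all `x`. The functions `f`, `g` are meant to be
non-negative and measurable; the measure may be infinite, so integrals take values in `[0, ∞]`. -/
def IsCoveringMeasure {n : ℕ} (f g : EuclideanSpace ℝ (Fin n) → ℝ)
    (μ : Measure (EuclideanSpace ℝ (Fin n))) : Prop :=
  ∀ x, ENNReal.ofReal (f x) ≤ ∫⁻ t, ENNReal.ofReal (g (x - t)) ∂μ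

/-- The `h`-covering number `N(f, g, h) = inf {∫ h dμ : μ * g ≥ f}`, an element of `[0, ∞]`; the
infimum is over all non-negative Borel measures on `ℝⁿ`. -/
noncomputable def weightedCoveringNumber {n : ℕ} (f g h : EuclideanSpace ℝ (Fin n) → ℝ) : ℝ≥0∞ :=
  ⨅ (μ : Measure (EuclideanSpace ℝ (Fin n))) (_ : IsCoveringMeasure f g μ),
    ∫⁻ x, ENNReal.ofReal (h x) ∂μ

/-- The functional covering number `N(f, g) = N(f, g, 1)`: the least total mass of a covering
measure of `f` by `g`. -/
noncomputable def coveringNumber {n : ℕ} (f g : EuclideanSpace ℝ (Fin n) → ℝ) : ℝ≥0∞ :=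
  weightedCoveringNumber f g (fun _ => 1)

/-- The class `LC_g(ℝⁿ)` of geometric log-concave functions: upper semi-continuous functions
`f : ℝⁿ → [0, 1]` with `log f` concave (with values in `[-∞, 0]`; equivalently the set where
`f > 0` is convex and `log f` is concave on it), with `max f = f 0 = 1`, and with finite and
positive integral. -/
structure IsGeometricLogConcave {n : ℕ} (f : EuclideanSpace ℝ (Fin n) → ℝ) : Prop where
  nonneg : ∀ x, 0 ≤ f x
  le_one : ∀ x, f x ≤ 1
  map_zero : f 0 = 1
  upperSemicontinuous : UpperSemicontinuous f
  concaveOn_log : ConcaveOn ℝ {x | 0 < f x} (fun x => Real.log (f x))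
  integrable : Integrable f volume
  integral_pos : 0 < ∫ x, f x

/-- The dilation `f_l(x) = f(x / l) ^ l`, for `l > 0`. -/
noncomputable def lcDilate {n : ℕ} (f : EuclideanSpace ℝ (Fin n) → ℝ) (l : ℝ) :
    EuclideanSpace ℝ (Fin n) → ℝ :=
  fun x => f (l⁻¹ • x) ^ l

/-! Write `g = f_l`. Log-concavity gives `f_k(x) f_l(y) ≤ f_{k+l}(x + y)`, so `f(x) g(a - (x - t)) ≤
f_{1+l}(t + a)`. Multiplying by `g(x - t)` and integrating in `t` shows that the density `f_{1+l}(t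
+ a)`, divided by `(g * g)(a)`, covers `f`; hence `N(f, g) (g * g)(a) ≤ ∫ f_{1+l}`
(`coveringNumber_mul_conv_le`). For even `f`, `(g * g)(0) = ∫ g²`; in general `sup (g * g) ≥ 2⁻ⁿ ∫
g²` (`lintegral_sq_le_iSup_conv`), which costs the extra `2ⁿ`. Scaling and `∫ f^(1+l) ≤ ∫ f^(2l)`
then leave the factor `((1 + l) / l)ⁿ → 2ⁿ`. The limit exists because `N(f, f_l)` decreases in `l`.
-/

theorem EuclideanSpace.lintegral_comp_inv_smul {n : ℕ} {r : ℝ} (hr : 0 < r)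
    (F : EuclideanSpace ℝ (Fin n) → ℝ≥0∞) (hF : Measurable F) :
    ∫⁻ x, F (r⁻¹ • x) = ENNReal.ofReal r ^ n * ∫⁻ x, F x := by
  have h1 : ∫⁻ x, F (r⁻¹ • x) = ∫⁻ x, F x ∂(Measure.map (r⁻¹ • ·) volume) :=
    (lintegral_map hF (measurable_const_smul _)).symm
  rw [h1, Measure.map_addHaar_smul _ (inv_ne_zero hr.ne'), lintegral_smul_measure,
    finrank_euclideanSpace_fin, inv_pow, inv_inv, abs_of_pos (pow_pos hr n),
    ENNReal.ofReal_pow hr.le, smul_eq_mul]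

theorem coveringNumber_anti_right {n : ℕ} {f g g' : EuclideanSpace ℝ (Fin n) → ℝ}
    (h : ∀ x, g x ≤ g' x) : coveringNumber f g' ≤ coveringNumber f g :=
  le_iInf₂ fun μ hμ => iInf₂_le μ fun x =>
    (hμ x).trans (lintegral_mono fun t => ENNReal.ofReal_le_ofReal (h (x - t)))

theorem coveringNumber_mul_le_lintegral {n : ℕ} {f g : EuclideanSpace ℝ (Fin n) → ℝ}
    (hf : f 0 = 1) (hg : Measurable g) (hg1 : ∀ x, g x ≤ 1)
    {h : EuclideanSpace ℝ (Fin n) → ℝ≥0∞} (hh : Measurable h) {c : ℝ≥0∞}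
    (hc : ∀ x, c * ENNReal.ofReal (f x) ≤ ∫⁻ t, ENNReal.ofReal (g (x - t)) * h t) :
    coveringNumber f g * c ≤ ∫⁻ t, h t := by
  rcases eq_or_ne c 0 with rfl | h0
  · simp
  rcases eq_or_ne c ∞ with rfl | htop
  -- Normalising by `c` is impossible here, but `x = 0` with `f 0 = 1` and `g ≤ 1` forces `∫ h = ∞`.
  · refine le_top.trans (le_trans ?_ (lintegral_mono (f := fun t => ENNReal.ofReal (g (0 - t)) * h t)
      fun t => mul_le_of_le_one_left' (ENNReal.ofReal_le_one.2 (hg1 _))))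
    simpa [hf] using hc 0
  rw [← ENNReal.le_div_iff_mul_le (Or.inl h0) (Or.inl htop)]
  refine (iInf₂_le (c⁻¹ • volume.withDensity h) fun x => ?_).trans ?_
  · rw [lintegral_smul_measure, lintegral_withDensity_eq_lintegral_mul _ hh (by fun_prop),
      smul_eq_mul]
    calc ENNReal.ofReal (f x) = c⁻¹ * (c * ENNReal.ofReal (f x)) := by
          rw [← mul_assoc, ENNReal.inv_mul_cancel h0 htop, one_mul]
      _ ≤ _ := by
          gcongr
          refine (hc x).trans_eq (lintegral_congr fun t => ?_)
          simp [mul_comm]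
  · simp [ENNReal.div_eq_inv_mul]

/-- The square integral of a midpoint log-concave function is at most `2 ^ n` times the supremum
of its self-convolution. -/
theorem lintegral_sq_le_iSup_conv {n : ℕ} {G : EuclideanSpace ℝ (Fin n) → ℝ≥0∞}
    (hG : Measurable G) (hmid : ∀ x y, G x * G y ≤ G ((2 : ℝ)⁻¹ • (x + y)) ^ 2)
    (h0 : ∫⁻ x, G x ^ 2 ≠ 0) (htop : ∫⁻ x, G x ^ 2 ≠ ∞) :
    ∫⁻ x, G x ^ 2 ≤ 2 ^ n * ⨆ a, ∫⁻ s, G (a - s) * G s := by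
  set I := ∫⁻ x, G x ^ 2 with hI
  set M := ⨆ a, ∫⁻ s, G (a - s) * G s with hM
  have key : I * I ≤ (2 ^ n * M) * I := by
    calc I * I = ∫⁻ s, ∫⁻ a, G (a - s) ^ 2 * G s ^ 2 := by
          have hinner (s) : ∫⁻ a, G (a - s) ^ 2 * G s ^ 2 = I * G s ^ 2 := by
            rw [lintegral_mul_const _ (by fun_prop),
              lintegral_sub_right_eq_self (fun a => G a ^ 2) s]
          simp_rw [hinner]
          rw [lintegral_const_mul _ (by fun_prop)]
      _ = ∫⁻ a, ∫⁻ s, G (a - s) ^ 2 * G s ^ 2 := lintegral_lintegral_swap (by fun_prop)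
      _ ≤ ∫⁻ a, M * G ((2 : ℝ)⁻¹ • a) ^ 2 := by
          refine lintegral_mono fun a => ?_
          calc ∫⁻ s, G (a - s) ^ 2 * G s ^ 2
              ≤ ∫⁻ s, (G (a - s) * G s) * G ((2 : ℝ)⁻¹ • a) ^ 2 := by
                refine lintegral_mono fun s => ?_
                -- Only one of the two factors `G (a - s) * G s` is bounded by the midpoint value;
                -- the other is kept to form the convolution.
                rw [← mul_pow, sq]
                gcongr
                simpa using hmid (a - s) s
            _ = (∫⁻ s, G (a - s) * G s) * G ((2 : ℝ)⁻¹ • a) ^ 2 :=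
                lintegral_mul_const _ (by fun_prop)
            _ ≤ _ := by
                gcongr
                exact le_iSup (fun a => ∫⁻ s, G (a - s) * G s) a
      _ = (2 ^ n * M) * I := by
          rw [lintegral_const_mul _ (by fun_prop),
            EuclideanSpace.lintegral_comp_inv_smul two_pos (fun a => G a ^ 2) (by fun_prop)]
          simp only [ENNReal.ofReal_ofNat]
          ring
  exact (ENNReal.mul_le_mul_iff_left h0 htop).1 key

namespace IsGeometricLogConcave

variable {n : ℕ} {f : EuclideanSpace ℝ (Fin n) → ℝ}

theorem measurable (hf : IsGeometricLogConcave f) : Measurable f :=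
  hf.upperSemicontinuous.measurable

theorem rpow_mul_rpow_le (hf : IsGeometricLogConcave f) {a b : ℝ} (ha : 0 < a) (hb : 0 < b)
    (hab : a + b = 1) (x y : EuclideanSpace ℝ (Fin n)) :
    f x ^ a * f y ^ b ≤ f (a • x + b • y) := by
  rcases (hf.nonneg x).eq_or_lt with hx | hx
  · simpa [← hx, Real.zero_rpow ha.ne'] using hf.nonneg _
  rcases (hf.nonneg y).eq_or_lt with hy | hy
  · simpa [← hy, Real.zero_rpow hb.ne'] using hf.nonneg _
  have hpos : 0 < f (a • x + b • y) := hf.concaveOn_log.1 hx hy ha.le hb.le hab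
  rw [← Real.log_le_log_iff (by positivity) hpos, Real.log_mul (by positivity) (by positivity),
    Real.log_rpow hx, Real.log_rpow hy]
  exact hf.concaveOn_log.2 hx hy ha.le hb.le hab

/-- Log-concavity at `x / k`, `y / l` with weights `k / (k + l)`, `l / (k + l)`, raised to the power
`k + l`. -/
theorem lcDilate_mul_lcDilate_le (hf : IsGeometricLogConcave f) {k l : ℝ} (hk : 0 < k)
    (hl : 0 < l) (x y : EuclideanSpace ℝ (Fin n)) :
    lcDilate f k x * lcDilate f l y ≤ lcDilate f (k + l) (x + y) := by
  have hkl : 0 < k + l := by positivity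
  have h := hf.rpow_mul_rpow_le (div_pos hk hkl) (div_pos hl hkl) (by field_simp)
    (k⁻¹ • x) (l⁻¹ • y)
  have hxy : (k / (k + l)) • k⁻¹ • x + (l / (k + l)) • l⁻¹ • y = (k + l)⁻¹ • (x + y) := by
    rw [smul_smul, smul_smul, smul_add]
    congr 2 <;> field_simp
  rw [hxy] at h
  have hx := hf.nonneg (k⁻¹ • x)
  have hy := hf.nonneg (l⁻¹ • y)
  have h' := Real.rpow_le_rpow (by positivity) h hkl.le
  rwa [Real.mul_rpow (by positivity) (by positivity), ← Real.rpow_mul hx, ← Real.rpow_mul hy,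
    div_mul_cancel₀ _ hkl.ne', div_mul_cancel₀ _ hkl.ne'] at h'

theorem lcDilate_mono (hf : IsGeometricLogConcave f) {k l : ℝ} (hk : 0 < k) (hkl : k ≤ l)
    (x : EuclideanSpace ℝ (Fin n)) : lcDilate f k x ≤ lcDilate f l x := by
  rcases hkl.eq_or_lt with rfl | hkl
  · rfl
  simpa [lcDilate, hf.map_zero] using hf.lcDilate_mul_lcDilate_le hk (sub_pos.2 hkl) x 0

theorem lcDilate_nonneg (hf : IsGeometricLogConcave f) (l : ℝ) (x : EuclideanSpace ℝ (Fin n)) :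
    0 ≤ lcDilate f l x :=
  Real.rpow_nonneg (hf.nonneg _) _

theorem lcDilate_le_one (hf : IsGeometricLogConcave f) {l : ℝ} (hl : 0 ≤ l)
    (x : EuclideanSpace ℝ (Fin n)) : lcDilate f l x ≤ 1 :=
  Real.rpow_le_one (hf.nonneg _) (hf.le_one _) hl

theorem measurable_lcDilate (hf : IsGeometricLogConcave f) (l : ℝ) : Measurable (lcDilate f l) :=
  (hf.measurable.comp (measurable_const_smul l⁻¹)).pow_const l

theorem lintegral_lcDilate (hf : IsGeometricLogConcave f) {l : ℝ} (hl : 0 < l) :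
    ∫⁻ x, ENNReal.ofReal (lcDilate f l x) =
      ENNReal.ofReal l ^ n * ∫⁻ x, ENNReal.ofReal (f x ^ l) :=
  EuclideanSpace.lintegral_comp_inv_smul hl (fun x => ENNReal.ofReal (f x ^ l))
    (hf.measurable.pow_const l).ennreal_ofReal

theorem lintegral_lcDilate_sq (hf : IsGeometricLogConcave f) {l : ℝ} (hl : 0 < l) :
    ∫⁻ x, ENNReal.ofReal (lcDilate f l x) ^ 2 =
      ENNReal.ofReal l ^ n * ∫⁻ x, ENNReal.ofReal (f x ^ (2 * l)) := by
  rw [← EuclideanSpace.lintegral_comp_inv_smul hl (fun x => ENNReal.ofReal (f x ^ (2 * l)))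
    (hf.measurable.pow_const _).ennreal_ofReal]
  refine lintegral_congr fun x => ?_
  rw [← ENNReal.ofReal_pow (hf.lcDilate_nonneg l x), lcDilate, mul_comm 2 l,
    Real.rpow_mul (hf.nonneg _), Real.rpow_two]

theorem lintegral_rpow_anti (hf : IsGeometricLogConcave f) {p q : ℝ} (hp : 0 < p) (hpq : p ≤ q) :
    ∫⁻ x, ENNReal.ofReal (f x ^ q) ≤ ∫⁻ x, ENNReal.ofReal (f x ^ p) :=
  lintegral_mono fun x => ENNReal.ofReal_le_ofReal <|
    Real.rpow_le_rpow_of_exponent_ge' (hf.nonneg x) (hf.le_one x) hp.le hpq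

theorem lintegral_rpow_ne_top (hf : IsGeometricLogConcave f) {p : ℝ} (hp : 1 ≤ p) :
    ∫⁻ x, ENNReal.ofReal (f x ^ p) ≠ ∞ := by
  refine ((hf.lintegral_rpow_anti one_pos hp).trans_lt ?_).ne
  simpa using hf.integrable.lintegral_lt_top

theorem lintegral_rpow_ne_zero (hf : IsGeometricLogConcave f) (p : ℝ) :
    ∫⁻ x, ENNReal.ofReal (f x ^ p) ≠ 0 := by
  intro h
  rw [lintegral_eq_zero_iff (hf.measurable.pow_const p).ennreal_ofReal] at h
  refine hf.integral_pos.ne' (integral_eq_zero_of_ae ?_)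
  filter_upwards [h] with x hx
  have hx : f x ^ p ≤ 0 := ENNReal.ofReal_eq_zero.1 hx
  by_contra hne
  exact (Real.rpow_pos_of_pos ((hf.nonneg x).lt_of_ne' hne) p).not_ge hx

/-- Covering `f` by its dilate `g = lcDilate f l`, using the measure with density proportional to
a translate of `lcDilate f (1 + l)`. -/
theorem coveringNumber_mul_conv_le (hf : IsGeometricLogConcave f) {l : ℝ} (hl : 0 < l)
    (a : EuclideanSpace ℝ (Fin n)) :
    coveringNumber f (lcDilate f l) *
        ∫⁻ s, ENNReal.ofReal (lcDilate f l (a - s)) * ENNReal.ofReal (lcDilate f l s) ≤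
      ∫⁻ x, ENNReal.ofReal (lcDilate f (1 + l) x) := by
  have hg := hf.measurable_lcDilate l
  have hh := hf.measurable_lcDilate (1 + l)
  rw [← lintegral_add_right_eq_self (fun x => ENNReal.ofReal (lcDilate f (1 + l) x)) a]
  refine coveringNumber_mul_le_lintegral hf.map_zero hg (hf.lcDilate_le_one hl.le) (by fun_prop)
    fun x => ?_
  rw [← lintegral_sub_left_eq_self
    (fun s => ENNReal.ofReal (lcDilate f l (a - s)) * ENNReal.ofReal (lcDilate f l s)) x,
    ← lintegral_mul_const _ (by fun_prop)]
  refine lintegral_mono fun t => ?_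
  rw [mul_comm (ENNReal.ofReal (lcDilate f l (a - (x - t)))), mul_assoc]
  gcongr
  rw [← ENNReal.ofReal_mul (hf.lcDilate_nonneg _ _)]
  refine ENNReal.ofReal_le_ofReal ?_
  have h := hf.lcDilate_mul_lcDilate_le one_pos hl x (a - (x - t))
  -- The bound no longer depends on `x`, so one density serves every `x`.
  rw [show x + (a - (x - t)) = t + a by abel] at h
  simpa [lcDilate, mul_comm] using h

theorem coveringNumber_le_of_mul_lintegral_sq_le (hf : IsGeometricLogConcave f) {l : ℝ}
    (hl : 1 / 2 < l) (hl1 : l < 1) {C : ℝ≥0∞}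
    (h : coveringNumber f (lcDilate f l) * ∫⁻ x, ENNReal.ofReal (lcDilate f l x) ^ 2 ≤
      C * ∫⁻ x, ENNReal.ofReal (lcDilate f (1 + l) x)) :
    coveringNumber f (lcDilate f l) ≤ C * ENNReal.ofReal ((1 + l) / l) ^ n := by
  have hl0 : 0 < l := by linarith
  rw [hf.lintegral_lcDilate_sq hl0, hf.lintegral_lcDilate (by positivity)] at h
  have hK0 := hf.lintegral_rpow_ne_zero (2 * l)
  -- `l > 1/2` gives `2 * l ≥ 1`, hence a finite integral that can be cancelled.
  have hKt := hf.lintegral_rpow_ne_top (p := 2 * l) (by linarith)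
  -- `l < 1` gives `2 * l ≤ 1 + l`, and `f ≤ 1`.
  have hJK := hf.lintegral_rpow_anti (p := 2 * l) (q := 1 + l) (by positivity) (by linarith)
  have hln : ENNReal.ofReal l ^ n ≠ 0 := pow_ne_zero _ (by simpa using hl0)
  have hlt : ENNReal.ofReal l ^ n ≠ ∞ := ENNReal.pow_ne_top ENNReal.ofReal_ne_top
  refine (ENNReal.mul_le_mul_iff_left (mul_ne_zero hln hK0) (ENNReal.mul_ne_top hlt hKt)).1
    (h.trans ?_)
  calc C * (ENNReal.ofReal (1 + l) ^ n * ∫⁻ x, ENNReal.ofReal (f x ^ (1 + l)))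
      ≤ C * (ENNReal.ofReal (1 + l) ^ n * ∫⁻ x, ENNReal.ofReal (f x ^ (2 * l))) := by gcongr
    _ = C * ((ENNReal.ofReal ((1 + l) / l) * ENNReal.ofReal l) ^ n *
          ∫⁻ x, ENNReal.ofReal (f x ^ (2 * l))) := by
        rw [← ENNReal.ofReal_mul (by positivity), div_mul_cancel₀ _ hl0.ne']
    _ = _ := by rw [mul_pow]; ring

theorem coveringNumber_lcDilate_le_of_even (hf : IsGeometricLogConcave f) (he : Function.Even f)
    {l : ℝ} (hl : 1 / 2 < l) (hl1 : l < 1) :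
    coveringNumber f (lcDilate f l) ≤ 1 * ENNReal.ofReal ((1 + l) / l) ^ n := by
  refine hf.coveringNumber_le_of_mul_lintegral_sq_le hl hl1 ?_
  have h := hf.coveringNumber_mul_conv_le (l := l) (by linarith) 0
  have hev (s) : lcDilate f l (0 - s) = lcDilate f l s := by simp [lcDilate, he _]
  simpa only [hev, ← sq, one_mul] using h

theorem coveringNumber_lcDilate_le (hf : IsGeometricLogConcave f)
    {l : ℝ} (hl : 1 / 2 < l) (hl1 : l < 1) :
    coveringNumber f (lcDilate f l) ≤ 2 ^ n * ENNReal.ofReal ((1 + l) / l) ^ n := by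
  have hl0 : 0 < l := by linarith
  refine hf.coveringNumber_le_of_mul_lintegral_sq_le hl hl1 ?_
  have hmid (x y) : ENNReal.ofReal (lcDilate f l x) * ENNReal.ofReal (lcDilate f l y) ≤
      ENNReal.ofReal (lcDilate f l ((2 : ℝ)⁻¹ • (x + y))) ^ 2 := by
    rw [← ENNReal.ofReal_mul (hf.lcDilate_nonneg _ _),
      ← ENNReal.ofReal_pow (hf.lcDilate_nonneg _ _)]
    refine ENNReal.ofReal_le_ofReal ((hf.lcDilate_mul_lcDilate_le hl0 hl0 x y).trans_eq ?_)
    rw [lcDilate, lcDilate, ← Real.rpow_two, ← Real.rpow_mul (hf.nonneg _), smul_smul,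
      ← two_mul, mul_inv, mul_comm l⁻¹, mul_comm l 2]
  have hI := hf.lintegral_lcDilate_sq hl0
  have h := lintegral_sq_le_iSup_conv (hf.measurable_lcDilate l).ennreal_ofReal hmid
    (by
      rw [hI]
      exact mul_ne_zero (pow_ne_zero _ (by simpa using hl0))
        (hf.lintegral_rpow_ne_zero _))
    (by
      rw [hI]
      exact ENNReal.mul_ne_top (ENNReal.pow_ne_top ENNReal.ofReal_ne_top)
        (hf.lintegral_rpow_ne_top (by linarith)))
  refine (mul_le_mul_right h _).trans ?_
  rw [mul_left_comm, ENNReal.mul_iSup]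
  gcongr
  exact iSup_le fun a => hf.coveringNumber_mul_conv_le hl0 a

theorem exists_tendsto_coveringNumber_lcDilate (hf : IsGeometricLogConcave f) :
    ∃ L : ℝ≥0∞, Tendsto (fun l : ℝ => coveringNumber f (lcDilate f l)) (𝓝[<] 1) (𝓝 L) :=
  ⟨_, AntitoneOn.tendsto_nhdsWithin_Ioo_left (y := 0) ⟨1 / 2, by norm_num, by norm_num⟩
    (fun _ hk _ _ hkl => coveringNumber_anti_right (hf.lcDilate_mono hk.1 hkl)) (OrderBot.bddBelow _)⟩

end IsGeometricLogConcave

theorem le_of_tendsto_of_le_mul_add_div_pow {n : ℕ} {u : ℝ → ℝ≥0∞} {L C : ℝ≥0∞} (hC : C ≠ ∞)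
    (hu : Tendsto u (𝓝[<] 1) (𝓝 L))
    (h : ∀ l, 1 / 2 < l → l < 1 → u l ≤ C * ENNReal.ofReal ((1 + l) / l) ^ n) :
    L ≤ C * 2 ^ n := by
  have hlim : Tendsto (fun l : ℝ => C * ENNReal.ofReal ((1 + l) / l) ^ n) (𝓝[<] 1)
      (𝓝 (C * 2 ^ n)) := by
    have h1 : ContinuousAt (fun l : ℝ => (1 + l) / l) 1 :=
      (continuousAt_const.add continuousAt_id).div continuousAt_id one_ne_zero
    have h2 : Tendsto (fun l : ℝ => (1 + l) / l) (𝓝[<] 1) (𝓝 2) := by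
      have := h1.tendsto.mono_left (nhdsWithin_le_nhds (s := Set.Iio 1))
      norm_num at this
      exact this
    have h3 := ENNReal.tendsto_ofReal h2
    rw [ENNReal.ofReal_ofNat] at h3
    exact ENNReal.Tendsto.const_mul (ENNReal.Tendsto.pow h3) (Or.inr hC)
  refine le_of_tendsto_of_tendsto hu hlim ?_
  filter_upwards [Ioo_mem_nhdsLT (show (1 / 2 : ℝ) < 1 by norm_num)] with l hl
  exact h l hl.1 hl.2

theorem theorem4p5 (n : ℕ) (f : EuclideanSpace ℝ (Fin n) → ℝ) (hf : IsGeometricLogConcave f) :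
    (Function.Even f → ∃ L : ℝ≥0∞, L ≤ 2 ^ n ∧
      Tendsto (fun l : ℝ => coveringNumber f (lcDilate f l)) (𝓝[<] 1) (𝓝 L)) ∧
    (∃ L : ℝ≥0∞, L ≤ 4 ^ n ∧
      Tendsto (fun l : ℝ => coveringNumber f (lcDilate f l)) (𝓝[<] 1) (𝓝 L)) := by
  obtain ⟨L, hL⟩ := hf.exists_tendsto_coveringNumber_lcDilate
  refine ⟨fun he => ⟨L, ?_, hL⟩, L, ?_, hL⟩
  · rw [← one_mul (2 ^ n)]
    exact le_of_tendsto_of_le_mul_add_div_pow ENNReal.one_ne_top hL fun l =>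
      hf.coveringNumber_lcDilate_le_of_even he
  · rw [show (4 : ℝ≥0∞) = 2 * 2 by norm_num, mul_pow]
    exact le_of_tendsto_of_le_mul_add_div_pow (by simp) hL fun l => hf.coveringNumber_lcDilate_le
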